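/- A Dyck path of semilength $n$ is a lattice path from $(0,0)$ to $(2n,0)$ with steps $U=(1,1)$ and $D=(1,-1)$ that never goes below the $x$-axis; it is identified with a word in $\{U,D\}$. Let $w_{n,k,m}$ be the number of Dyck paths of semilength $n$ with exactly $k$ occurrences of $UD$ and exactly $m$ occurrences of $UUD$ as factors (blocks of consecutive letters), and let $W_{n,k}(x)=\sum_{m=0}^{k}w_{n,k,m}x^m$. For nonzero real-rooted polynomials $F,G$ with nonnegative real coefficients, with zeros (counted with multiplicity) $\alpha_1\ge\alpha_2\ge\cdots$ and $\beta_1\ge\beta_2\ge\cdots$ respectively, write $G\preccurlyeq F$ (equivalently $F\succcurlyeq G$) if either $\deg F=\deg G=d$ and $\beta_d\le\alpha_d\le\beta_{d-1}\le\alpha_{d-1}\le\cdots\le\beta_1\le\alpha_1$, or $\deg F=\deg G+1=d$ and $\alpha_d\le\beta_{d-1}\le\alpha_{d-1}\le\cdots\le\beta_1\le\alpha_1$. By convention, also $a\preccurlyeq bx+c$ for all real $a,b,c$, and $F\preccurlyeq 0$, $0\preccurlyeq F$ for every real-rooted $F$. A finite sequence $F_1,\dots,F_n$ of real-rooted polynomials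 is called Sturm-unimodal if there is $1\le j\le n$ with $$F_1\preccurlyeq\cdots\preccurlyeq F_{j-1}\preccurlyeq F_j\succcurlyeq F_{j+1}\succcurlyeq\cdots\succcurlyeq F_n .$$ **Theorem.** For every $n\ge 1$, the polynomials $W_{n,1}(x),W_{n,2}(x),\dots,W_{n,n}(x)$ are all real-rooted, and the sequence $\{W_{n,k}(x)\}_{1\le k\le n}$ is Sturm-unimodal. -/

import Mathlib

namespace DyckSturm

open Polynomial

/-- The number of occurrences of `f` as a factor (block of consecutive letters) of the word `l`:
the number of positions of `l` at which `f` starts. -/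
def occ (f l : List DyckStep) : ℕ :=
  l.tails.countP (fun t => f.isPrefixOf t)

/-- `w n k m` is the number of Dyck paths of semilength `n` with exactly `k` occurrences of the
factor `UD` and exactly `m` occurrences of the factor `UUD`. -/
def w (n k m : ℕ) : ℕ :=
  (Finset.univ.filter (fun p : {p : DyckWord // p.semilength = n} =>
    occ [DyckStep.U, DyckStep.D] p.1.toList = k ∧
    occ [DyckStep.U, DyckStep.U, DyckStep.D] p.1.toList = m)).card

/-- The polynomial `W_{n,k}(x) = ∑_{m=0}^{k} w_{n,k,m} x^m`, with real coefficients. -/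
noncomputable def W (n k : ℕ) : ℝ[X] :=
  ∑ m ∈ Finset.range (k + 1), C (w n k m : ℝ) * X ^ m

/-- A real polynomial is real-rooted if it is a product of linear factors over `ℝ`
(constants, including `0`, are real-rooted). -/
def RealRooted (p : ℝ[X]) : Prop := p.Splits

/-- The real zeros of `p`, with multiplicity, in weakly decreasing order
(entry `i` of the list is the `(i+1)`-st largest zero). -/
noncomputable def zerosDesc (p : ℝ[X]) : List ℝ := p.roots.sort (· ≥ ·)

/-- The chain `⋯ ≤ β₂ ≤ α₂ ≤ β₁ ≤ α₁` for two lists `α`, `β`, over all the entries present.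
If both have length `n` it reads `βₙ ≤ αₙ ≤ ⋯ ≤ β₁ ≤ α₁`; if `α` has length `n` and `β` has
length `n - 1` it reads `αₙ ≤ βₙ₋₁ ≤ αₙ₋₁ ≤ ⋯ ≤ β₁ ≤ α₁`. -/
def Alternates (β α : List ℝ) : Prop :=
  (∀ (i : ℕ) (hβ : i < β.length) (hα : i < α.length), β[i] ≤ α[i]) ∧
  (∀ (i : ℕ) (hβ : i < β.length) (hα : i + 1 < α.length), α[i + 1] ≤ β[i])

/-- `Interlaces G F` is the relation `G ≼ F` between real-rooted polynomials. The first
alternative is the general definition, for polynomials with nonnegative coefficients; the others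
are the conventions `a ≼ b x + c`, `0 ≼ F` and `G ≼ 0`. -/
def Interlaces (G F : ℝ[X]) : Prop :=
  RealRooted G ∧ RealRooted F ∧
  (((∀ i, 0 ≤ G.coeff i) ∧ (∀ i, 0 ≤ F.coeff i) ∧ G ≠ 0 ∧ F ≠ 0 ∧
      (F.natDegree = G.natDegree ∨ F.natDegree = G.natDegree + 1) ∧
      Alternates (zerosDesc G) (zerosDesc F)) ∨
    (∃ a b c : ℝ, G = C a ∧ F = C b * X + C c) ∨ G = 0 ∨ F = 0)

/-- The finite sequence `F 1, …, F n` of real-rooted polynomials is Sturm-unimodal: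
`F 1 ≼ ⋯ ≼ F j ≽ F (j+1) ≽ ⋯ ≽ F n` for some `1 ≤ j ≤ n`. -/
def SturmUnimodal (n : ℕ) (F : ℕ → ℝ[X]) : Prop :=
  (∀ i, 1 ≤ i → i ≤ n → RealRooted (F i)) ∧
  ∃ j, 1 ≤ j ∧ j ≤ n ∧
    (∀ i, 1 ≤ i → i < j → Interlaces (F i) (F (i + 1))) ∧
    (∀ i, j ≤ i → i < n → Interlaces (F (i + 1)) (F i))

end DyckSturm

namespace DyckSturm

open Polynomial DyckStep

/-! ### Words all of whose suffixes have at most as many up steps as down steps -/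

/-! An exact formula for the coefficients reduces the theorem to interlacing of one family of
polynomials.

Dyck words are the balanced words with no suffix having more `U` than `D`. Dropping balance gives a
class closed under deleting the first letter, so counts by `UD` and `UUD` satisfy a recursion.
`suffixCount_eq_ballot` solves it: with `u` letters `U`, `d` letters `D` and `k ≥ 1`, the count is
(d+1-u)/k · C(d,k-1) times the number of compositions of `u` (the lengths of the `U`-runs) into `k`
parts, `m` of them at least two.

At `u = d = a+b+2`, `k = a+1` this gives W = c·x·P(a,b) with c > 0 and P = `narayanaPoly`
(`W_eq_narayanaPoly`). P is symmetric, so W_{n,k} and W_{n,n-k} are proportional for 0 < k < n, and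
the descending half mirrors the ascending one. `narayanaPoly_succ_left` shows that P(a+1,b)
alternates in sign at the zeros of P(a,b), so by induction on `a ≤ b` all zeros are simple and
negative. `narayanaPoly_shift` turns this into alternation of P(a+1,b) at the zeros of P(a,b+1) when
`a < b`, which is the interlacing of neighbours with the same `n`. -/

lemma cons_injective (x : DyckStep) : Function.Injective (List.cons x) :=
  fun _ _ h => (List.cons.inj h).2

/-- The words with `u` letters `U` and `d` letters `D` in which every suffix has at most as many
letters `U` as letters `D`. -/
def suffixWords : ℕ → ℕ → Finset (List DyckStep)
  | 0, 0 => {[]}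
  | _ + 1, 0 => ∅
  | 0, d + 1 => (suffixWords 0 d).map ⟨List.cons D, cons_injective D⟩
  | u + 1, d + 1 => (suffixWords (u + 1) d).map ⟨List.cons D, cons_injective D⟩ ∪
      if u ≤ d then (suffixWords u (d + 1)).map ⟨List.cons U, cons_injective U⟩ else ∅

lemma mem_suffixWords (u d : ℕ) (l : List DyckStep) :
    l ∈ suffixWords u d ↔ l.count U = u ∧ l.count D = d ∧
      ∀ i, (l.drop i).count U ≤ (l.drop i).count D := by
  induction l generalizing u d with
  | nil =>
    rcases u with _ | u <;> rcases d with _ | d <;> simp [suffixWords]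
    split_ifs <;> simp
  | cons x l ih =>
    have split : (∀ i, ((x :: l).drop i).count U ≤ ((x :: l).drop i).count D) ↔
        (x :: l).count U ≤ (x :: l).count D ∧ ∀ i, (l.drop i).count U ≤ (l.drop i).count D := by
      constructor
      · exact fun h => ⟨h 0, fun i => h (i + 1)⟩
      · rintro ⟨h0, h⟩ (_ | i)
        · exact h0
        · exact h i
    rw [split]
    have whole : (∀ i, (l.drop i).count U ≤ (l.drop i).count D) → l.count U ≤ l.count D :=
      fun h => h 0
    rcases u with _ | u <;> rcases d with _ | d <;> cases x <;> simp [suffixWords, ih]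
    · grind
    · grind
    · split_ifs with h
      · simp [ih]
        grind
      · simp
        grind
    · split_ifs <;> simp <;> grind

section Sums

variable {M : Type*} [AddCommMonoid M] (f : List DyckStep → M)

lemma sum_suffixWords_zero_succ (d : ℕ) :
    ∑ l ∈ suffixWords 0 (d + 1), f l = ∑ l ∈ suffixWords 0 d, f (D :: l) := by
  simp [suffixWords]

lemma sum_suffixWords_succ_succ {u d : ℕ} (h : u ≤ d) :
    ∑ l ∈ suffixWords (u + 1) (d + 1), f l =
      ∑ l ∈ suffixWords (u + 1) d, f (D :: l) + ∑ l ∈ suffixWords u (d + 1), f (U :: l) := by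
  rw [suffixWords, if_pos h, Finset.sum_union]
  · simp
  · rw [Finset.disjoint_left]
    simp

end Sums

lemma suffixWords_eq_empty {u d : ℕ} (h : d < u) : suffixWords u d = ∅ := by
  ext l
  rw [mem_suffixWords]
  simp only [Finset.notMem_empty, iff_false]
  rintro ⟨h1, h2, h3⟩
  have := h3 0
  simp only [List.drop_zero] at this
  omega

/-! ### Counting suffix words by their factors `UD` and `UUD` -/

/-- The indicator of the words with `k` factors `UD` and `m` factors `UUD`. -/
def factorInd (k m : ℕ) (l : List DyckStep) : ℚ :=
  if occ [U, D] l = k ∧ occ [U, U, D] l = m then 1 else 0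

lemma factorInd_D (k m : ℕ) (l : List DyckStep) : factorInd k m (D :: l) = factorInd k m l := by
  refine if_congr ?_ rfl rfl
  simp [occ, List.isPrefixOf]

lemma factorInd_UD_zero (m : ℕ) (l : List DyckStep) : factorInd 0 m (U :: D :: l) = 0 := by
  simp [factorInd, occ, List.isPrefixOf]

lemma factorInd_UD_succ (k m : ℕ) (l : List DyckStep) :
    factorInd (k + 1) m (U :: D :: l) = factorInd k m l := by
  refine if_congr ?_ rfl rfl
  simp [occ, List.isPrefixOf]

lemma factorInd_UUD_zero (m : ℕ) (l : List DyckStep) :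
    factorInd 0 m (U :: U :: D :: l) = 0 := by
  simp [factorInd, occ, List.isPrefixOf]

lemma factorInd_UUD_succ_zero (k : ℕ) (l : List DyckStep) :
    factorInd (k + 1) 0 (U :: U :: D :: l) = 0 := by
  simp [factorInd, occ, List.isPrefixOf]

lemma factorInd_UUD_succ_succ (k m : ℕ) (l : List DyckStep) :
    factorInd (k + 1) (m + 1) (U :: U :: D :: l) = factorInd k m l := by
  refine if_congr ?_ rfl rfl
  simp [occ, List.isPrefixOf]

lemma factorInd_UUU (k m : ℕ) (l : List DyckStep) :
    factorInd k m (U :: U :: U :: l) = factorInd k m (U :: U :: l) := by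
  refine if_congr ?_ rfl rfl
  simp [occ, List.isPrefixOf]

/-- The number of suffix words with `k` factors `UD` and `m` factors `UUD`. -/
def suffixCount (u d k m : ℕ) : ℚ := ∑ l ∈ suffixWords u d, factorInd k m l

/-- The number of words `U :: l` with `l` a suffix word, with `k` factors `UD` and
`m` factors `UUD`. -/
def suffixCountU (u d k m : ℕ) : ℚ := ∑ l ∈ suffixWords u d, factorInd k m (U :: l)

lemma suffixCount_zero_succ (d k m : ℕ) : suffixCount 0 (d + 1) k m = suffixCount 0 d k m := by
  simp [suffixCount, sum_suffixWords_zero_succ, factorInd_D]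

lemma suffixCount_succ_succ {u d : ℕ} (h : u ≤ d) (k m : ℕ) :
    suffixCount (u + 1) (d + 1) k m =
      suffixCount (u + 1) d k m + suffixCountU u (d + 1) k m := by
  simp [suffixCount, suffixCountU, sum_suffixWords_succ_succ _ h, factorInd_D]

/-- A third leading `U` creates no new factor, so `UU l` and `U l` count alike when `l` starts with
`U`; the last two sums correct for the `l` that start with `D`. This closes the recursion without
tracking longer prefixes. -/
lemma sum_factorInd_UU {u d : ℕ} (h : u ≤ d) (k m : ℕ) :
    ∑ l ∈ suffixWords u (d + 1), factorInd k m (U :: U :: l) =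
      suffixCountU u (d + 1) k m + ∑ l ∈ suffixWords u d, factorInd k m (U :: U :: D :: l) -
        ∑ l ∈ suffixWords u d, factorInd k m (U :: D :: l) := by
  rcases u with _ | u
  · simp [suffixCountU, sum_suffixWords_zero_succ]
  · simp only [suffixCountU, sum_suffixWords_succ_succ _ (Nat.le_of_succ_le h), factorInd_UUU]
    ring

/-- A word that starts with `U` and contains a `D` has a factor `UD`. -/
lemma suffixCountU_zero (u d m : ℕ) (h : u ≤ d) : suffixCountU u (d + 1) 0 m = 0 := by
  induction u with
  | zero => simp [suffixCountU, sum_suffixWords_zero_succ, factorInd_UD_zero]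
  | succ u ih =>
    rw [suffixCountU, sum_suffixWords_succ_succ _ (by omega), sum_factorInd_UU (by omega),
      ih (by omega)]
    simp [factorInd_UD_zero, factorInd_UUD_zero]

lemma suffixCountU_zero_succ (d k m : ℕ) :
    suffixCountU 0 (d + 1) (k + 1) m = suffixCount 0 d k m := by
  simp [suffixCountU, suffixCount, sum_suffixWords_zero_succ, factorInd_UD_succ]

lemma suffixCountU_succ_succ_zero {u d : ℕ} (h : u ≤ d) (k : ℕ) :
    suffixCountU (u + 1) (d + 1) (k + 1) 0 =
      suffixCount (u + 1) d k 0 + suffixCountU u (d + 1) (k + 1) 0 - suffixCount u d k 0 := by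
  rw [suffixCountU, sum_suffixWords_succ_succ _ h, sum_factorInd_UU h]
  simp [suffixCount, factorInd_UD_succ, factorInd_UUD_succ_zero]
  ring

lemma suffixCountU_succ_succ_succ {u d : ℕ} (h : u ≤ d) (k m : ℕ) :
    suffixCountU (u + 1) (d + 1) (k + 1) (m + 1) =
      suffixCount (u + 1) d k (m + 1) + suffixCountU u (d + 1) (k + 1) (m + 1) +
        suffixCount u d k m - suffixCount u d k (m + 1) := by
  rw [suffixCountU, sum_suffixWords_succ_succ _ h, sum_factorInd_UU h]
  simp [suffixCount, factorInd_UD_succ, factorInd_UUD_succ_succ]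
  ring

/-! ### The closed form -/

/-- The number of compositions of `N` into `m` positive parts. -/
def compCount : ℕ → ℕ → ℕ
  | 0, 0 => 1
  | 0, _ + 1 => 0
  | _ + 1, 0 => 0
  | N + 1, m + 1 => N.choose m

lemma compCount_succ_succ (N m : ℕ) :
    compCount (N + 1) (m + 1) = compCount N m + compCount N (m + 1) := by
  rcases N with _ | N <;> rcases m with _ | m <;> simp [compCount, Nat.choose_succ_succ]

lemma mul_compCount (N m : ℕ) : N * compCount N m = m * compCount (N + 1) (m + 1) := by
  rcases N with _ | N <;> rcases m with _ | m <;> simp [compCount]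
  rw [Nat.add_one_mul_choose_eq, mul_comm]

/-- The number of compositions of `u` into `k` positive parts, `m` of which are at least two. -/
def bigPartCount (u k m : ℕ) : ℚ := if k ≤ u then k.choose m * compCount (u - k) m else 0

lemma bigPartCount_of_lt {u k : ℕ} (h : u < k) (m : ℕ) : bigPartCount u k m = 0 :=
  if_neg (by omega)

lemma bigPartCount_self_succ (k m : ℕ) : bigPartCount k k (m + 1) = 0 := by
  simp [bigPartCount, compCount]

lemma bigPartCount_self_zero (k : ℕ) : bigPartCount k k 0 = 1 := by
  simp [bigPartCount, compCount]

lemma bigPartCount_add_zero (k N : ℕ) : bigPartCount (k + N + 1) k 0 = 0 := by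
  simp [bigPartCount, show k + N + 1 - k = N + 1 by omega, compCount]

lemma bigPartCount_add (k N m : ℕ) :
    bigPartCount (k + N) k m = k.choose m * compCount N m := by
  simp [bigPartCount]

lemma bigPartCount_zero_of_ne {u k : ℕ} (h : u ≠ k) : bigPartCount u k 0 = 0 := by
  rcases lt_or_gt_of_ne h with h | h
  · exact bigPartCount_of_lt h 0
  · obtain ⟨N, rfl⟩ := Nat.exists_eq_add_of_lt h
    exact bigPartCount_add_zero k N

lemma bigPartCount_succ_zero (v k : ℕ) :
    bigPartCount (v + 1) (k + 1) 0 = bigPartCount v k 0 := by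
  by_cases h : v = k
  · subst h; simp [bigPartCount_self_zero]
  · rw [bigPartCount_zero_of_ne h, bigPartCount_zero_of_ne (by omega)]

/-- With G = x + y x²/(1-x), the count is the coefficient of x^u y^m in G^k. This is the coefficient
form of (1-x) G^(k+1) = (x - x² + y x²) G^k. -/
lemma bigPartCount_rec (v k m : ℕ) :
    bigPartCount (v + 2) (k + 1) (m + 1) - bigPartCount (v + 1) (k + 1) (m + 1) =
      bigPartCount (v + 1) k (m + 1) + bigPartCount v k m - bigPartCount v k (m + 1) := by
  rcases lt_or_ge v k with h | h
  · rcases Nat.eq_or_lt_of_le (Nat.succ_le_of_lt h) with h' | h'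
    · subst h'
      rw [bigPartCount_self_succ, bigPartCount_self_succ]
      simp [bigPartCount_of_lt]
    · rw [bigPartCount_of_lt, bigPartCount_of_lt, bigPartCount_of_lt, bigPartCount_of_lt,
        bigPartCount_of_lt] <;> first | omega | simp
  · obtain ⟨N, rfl⟩ := Nat.exists_eq_add_of_le h
    rw [show k + N + 2 = k + 1 + (N + 1) by ring, show k + N + 1 = k + (N + 1) by ring,
      bigPartCount_add, bigPartCount_add, bigPartCount_add, bigPartCount_add,
      show k + (N + 1) = k + 1 + N by ring, bigPartCount_add, compCount_succ_succ,
      Nat.choose_succ_succ]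
    push_cast
    ring

/-- In the same notation, this is (k+1)(1-x)·x(G^(k+2))' = (k+2)(x - x² + y x²)·x(G^(k+1))', which
follows from (k+1)(G^(k+2))' = (k+2) G (G^(k+1))'. -/
lemma bigPartCount_weighted_rec (v k m : ℕ) :
    ((k : ℚ) + 1) * ((v + 2) * bigPartCount (v + 2) (k + 2) (m + 1) -
        (v + 1) * bigPartCount (v + 1) (k + 2) (m + 1)) =
      (k + 2) * ((v + 1) * bigPartCount (v + 1) (k + 1) (m + 1) + v * bigPartCount v (k + 1) m -
        v * bigPartCount v (k + 1) (m + 1)) := by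
  rcases lt_or_ge v (k + 1) with h | h
  · rcases Nat.eq_or_lt_of_le (Nat.succ_le_of_lt h) with h' | h'
    · obtain rfl : v = k := by omega
      rw [bigPartCount_self_succ, bigPartCount_self_succ]
      simp [bigPartCount_of_lt]
    · rw [bigPartCount_of_lt, bigPartCount_of_lt, bigPartCount_of_lt, bigPartCount_of_lt,
        bigPartCount_of_lt] <;> first | omega | simp
  · obtain ⟨N, rfl⟩ := Nat.exists_eq_add_of_le h
    have e1 := bigPartCount_add (k + 2) (N + 1) (m + 1)
    have e2 := bigPartCount_add (k + 2) N (m + 1)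
    have e3 := bigPartCount_add (k + 1) (N + 1) (m + 1)
    rw [show k + 1 + N + 2 = k + 2 + (N + 1) by ring, e1,
      show k + 1 + N + 1 = k + 2 + N by ring, e2,
      show k + 2 + N = k + 1 + (N + 1) by ring, e3, bigPartCount_add, bigPartCount_add]
    have h1 : ((k : ℚ) + 2) * (k + 1).choose m = (k + 2).choose (m + 1) * (m + 1) := by
      exact_mod_cast Nat.add_one_mul_choose_eq (k + 1) m
    have h2 : ((k + 2).choose (m + 1) : ℚ) = (k + 1).choose m + (k + 1).choose (m + 1) := by
      exact_mod_cast Nat.choose_succ_succ (k + 1) m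
    have h3 : (compCount (N + 1) (m + 1) : ℚ) = compCount N m + compCount N (m + 1) := by
      exact_mod_cast compCount_succ_succ N m
    have h4 : (N : ℚ) * compCount N m = m * compCount (N + 1) (m + 1) := by
      exact_mod_cast mul_compCount N m
    have hm : (m : ℚ) + 1 ≠ 0 := by positivity
    have h5 : ((k + 2).choose (m + 1) : ℚ) = (k + 2) * (k + 1).choose m / (m + 1) := by
      field_simp; linarith
    have h6 : ((k + 1).choose (m + 1) : ℚ) = (k + 1 - m) * (k + 1).choose m / (m + 1) := by
      field_simp; rw [h5] at h2; field_simp at h2; linarith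
    have h7 : (compCount N (m + 1) : ℚ) = compCount (N + 1) (m + 1) - compCount N m := by
      linarith
    rw [h5, h6, h7]
    push_cast
    field_simp
    linear_combination ((k + 1).choose m : ℚ) * (-h4)

/-- The number of suffix words with `k` factors `UD` and `m` factors `UUD`, in closed form. -/
def ballot (u d : ℕ) : ℕ → ℕ → ℚ
  | 0, m => bigPartCount u 0 m
  | k + 1, m =>
    ((d + 1).choose (k + 1) - u / (k + 1) * d.choose k) * bigPartCount u (k + 1) m

lemma ballot_zero_succ (u d m : ℕ) : ballot (u + 1) d 0 m = 0 := by
  rcases m with _ | m <;> simp [ballot, bigPartCount, compCount]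

lemma ballot_zero (d k m : ℕ) : ballot 0 (d + 1) k m = ballot 0 d k m := by
  rcases k with _ | k <;> simp [ballot, bigPartCount]

/-- The boundary condition: the bracket in the closed form equals (d+1-u)/(k+1) · C(d,k). -/
lemma ballot_succ_self (d k m : ℕ) : ballot (d + 1) d k m = 0 := by
  rcases k with _ | k
  · exact ballot_zero_succ d d m
  · have h : ((d : ℚ) + 1) * d.choose k = (d + 1).choose (k + 1) * (k + 1) := by
      exact_mod_cast Nat.add_one_mul_choose_eq d k
    have hk : (k : ℚ) + 1 ≠ 0 := by positivity
    simp only [ballot, Nat.cast_add, Nat.cast_one]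
    rw [div_mul_eq_mul_div, h, mul_div_cancel_right₀ _ hk, sub_self, zero_mul]

lemma ballot_first (d k m : ℕ) :
    ballot 1 (d + 1) (k + 1) m - ballot 1 d (k + 1) m = ballot 0 d k m := by
  rcases k with _ | k
  · rcases m with _ | m <;> simp [ballot, bigPartCount, compCount]
  · simp [ballot, bigPartCount]

lemma ballot_sub (u d k m : ℕ) :
    ballot u (d + 1) (k + 2) m - ballot u d (k + 2) m =
      ((d + 1).choose (k + 1) - u / (k + 2) * d.choose k) * bigPartCount u (k + 2) m := by
  simp only [ballot, Nat.choose_succ_succ (d + 1) (k + 1), Nat.choose_succ_succ d k]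
  push_cast
  ring

lemma ballot_sub_one (u d m : ℕ) :
    ballot u (d + 1) 1 m - ballot u d 1 m = bigPartCount u 1 m := by
  simp only [ballot]
  simp
  ring

lemma ballot_rec_zero (u d k : ℕ) :
    ballot (u + 2) (d + 1) (k + 1) 0 - ballot (u + 2) d (k + 1) 0 =
      ballot (u + 1) d k 0 + (ballot (u + 1) (d + 1) (k + 1) 0 - ballot (u + 1) d (k + 1) 0) -
        ballot u d k 0 := by
  rcases k with _ | k
  · simp only [zero_add, ballot_sub_one]
    simp only [ballot, bigPartCount_succ_zero]
    ring
  · have hk : (k : ℚ) + 1 ≠ 0 := by positivity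
    have hk' : (k : ℚ) + 2 ≠ 0 := by positivity
    simp only [ballot_sub]
    simp only [ballot, bigPartCount_succ_zero]
    push_cast
    rcases eq_or_ne u k with rfl | h
    · rw [bigPartCount_zero_of_ne (u := u) (k := u + 1) (by omega), bigPartCount_self_zero]
      field_simp
      ring
    · rw [bigPartCount_zero_of_ne h]
      rcases eq_or_ne u (k + 1) with rfl | h
      · rw [bigPartCount_self_zero]
        push_cast
        field_simp
        ring
      · rw [bigPartCount_zero_of_ne h]
        ring

lemma ballot_rec_succ (u d k m : ℕ) :
    ballot (u + 2) (d + 1) (k + 1) (m + 1) - ballot (u + 2) d (k + 1) (m + 1) =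
      ballot (u + 1) d k (m + 1) +
        (ballot (u + 1) (d + 1) (k + 1) (m + 1) - ballot (u + 1) d (k + 1) (m + 1)) +
        ballot u d k m - ballot u d k (m + 1) := by
  rcases k with _ | k
  · simp only [zero_add, ballot_sub_one]
    simp only [ballot]
    linear_combination bigPartCount_rec u 0 m
  · have hk : (k : ℚ) + 1 ≠ 0 := by positivity
    have hk' : (k : ℚ) + 2 ≠ 0 := by positivity
    have h1 := bigPartCount_rec u (k + 1) m
    have h2 := bigPartCount_weighted_rec u k m
    simp only [ballot_sub]
    simp only [ballot]
    push_cast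
    field_simp
    -- The terms with C(d+1,k+1) cancel by the plain recursion, those with C(d,k), which carry the
    -- factor `u`, by the weighted one.
    linear_combination ((k : ℚ) + 1) * (k + 2) * (d + 1).choose (k + 1) * h1 - d.choose k * h2

/-- The range includes `u = d + 1`, where both sides vanish, because deleting a leading `D` from a
balanced word leads there; beyond it the closed form need not vanish. -/
theorem suffixCount_eq_ballot (d u k m : ℕ) (h : u ≤ d + 1) :
    suffixCount u d k m = ballot u d k m := by
  induction d generalizing u k m with
  | zero =>
    obtain rfl | rfl : u = 0 ∨ u = 1 := by omega
    · rcases k with _ | k <;> rcases m with _ | m <;>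
        simp [suffixCount, suffixWords, factorInd, occ, ballot, bigPartCount, compCount,
          List.isPrefixOf]
    · rw [ballot_succ_self]
      simp [suffixCount, suffixWords]
  | succ d ih =>
    -- Words starting with `U` are all words minus those starting with `D`, which suggests this
    -- difference of closed forms.
    have key : ∀ u ≤ d, ∀ k m, suffixCountU u (d + 1) k m =
        ballot (u + 1) (d + 1) k m - ballot (u + 1) d k m := by
      intro u hu k m
      rcases k with _ | k
      · rw [suffixCountU_zero u d m hu, ballot_zero_succ, ballot_zero_succ, sub_zero]
      · induction u with
        | zero => rw [suffixCountU_zero_succ, ih _ _ _ (by omega), zero_add, ballot_first]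
        | succ u ihu =>
          rcases m with _ | m
          · rw [suffixCountU_succ_succ_zero (by omega), ih _ _ _ (by omega), ih _ _ _ (by omega),
              ihu (by omega), ballot_rec_zero]
          · rw [suffixCountU_succ_succ_succ (by omega), ih _ _ _ (by omega),
              ih _ _ _ (by omega), ih _ _ _ (by omega), ihu (by omega), ballot_rec_succ]
    rcases u with _ | u
    · rw [suffixCount_zero_succ, ih _ _ _ (by omega), ballot_zero]
    · rcases Nat.lt_or_ge d u with hu | hu
      · obtain rfl : u = d + 1 := by omega
        rw [ballot_succ_self, suffixCount, suffixWords_eq_empty (by omega), Finset.sum_empty]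
      · rw [suffixCount_succ_succ hu, ih _ _ _ (by omega), key u hu]
        ring

/-! ### Dyck words -/

lemma toList_mem_suffixWords (p : DyckWord) :
    p.toList ∈ suffixWords p.semilength p.semilength := by
  rw [mem_suffixWords]
  refine ⟨rfl, p.count_U_eq_count_D.symm, fun i => ?_⟩
  have h := p.count_D_le_count_U i
  have hU := congrArg (List.count U) (List.take_append_drop i p.toList)
  have hD := congrArg (List.count D) (List.take_append_drop i p.toList)
  rw [List.count_append] at hU hD
  have := p.count_U_eq_count_D
  omega

lemma exists_dyckWord_of_mem {n : ℕ} {l : List DyckStep} (hl : l ∈ suffixWords n n) :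
    ∃ p : DyckWord, p.semilength = n ∧ p.toList = l := by
  rw [mem_suffixWords] at hl
  obtain ⟨h1, h2, h3⟩ := hl
  refine ⟨⟨l, h1.trans h2.symm, fun i => ?_⟩, h1, rfl⟩
  have h := h3 i
  have hU := congrArg (List.count U) (List.take_append_drop i l)
  have hD := congrArg (List.count D) (List.take_append_drop i l)
  rw [List.count_append] at hU hD
  omega

lemma w_eq_suffixCount (n k m : ℕ) : (w n k m : ℚ) = suffixCount n n k m := by
  simp only [suffixCount, factorInd, Finset.sum_boole, w]
  congr 1
  refine Finset.card_bij (fun p _ => p.1.toList) ?_ ?_ ?_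
  · rintro ⟨p, rfl⟩ hp
    simpa [toList_mem_suffixWords p] using hp
  · rintro ⟨p, hp⟩ _ ⟨q, hq⟩ _ h
    exact Subtype.ext (DyckWord.ext h)
  · intro l hl
    rw [Finset.mem_filter] at hl
    obtain ⟨p, hp, rfl⟩ := exists_dyckWord_of_mem hl.1
    exact ⟨⟨p, hp⟩, by simpa using hl.2, rfl⟩

theorem w_succ (n k m : ℕ) :
    (w n (k + 1) m : ℚ) = n.choose k / (k + 1) * bigPartCount n (k + 1) m := by
  rw [w_eq_suffixCount, suffixCount_eq_ballot _ _ _ _ (by omega), ballot]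
  have h : ((n : ℚ) + 1) * n.choose k = (n + 1).choose (k + 1) * (k + 1) := by
    exact_mod_cast Nat.add_one_mul_choose_eq n k
  congr 1
  field_simp
  linarith

/-! ### Polynomials with simple real zeros -/

/-- `p` has positive leading coefficient and exactly the zeros `r 0 > r 1 > ⋯ > r (d - 1)`,
all simple. -/
structure HasSimpleZeros (d : ℕ) (r : ℕ → ℝ) (p : ℝ[X]) : Prop where
  strictAntiOn : StrictAntiOn r (Set.Iio d)
  pos : 0 < p.leadingCoeff
  eq_prod : p = C p.leadingCoeff * ∏ i ∈ Finset.range d, (X - C (r i))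

/-- Exactly the `i` factors with `j < i` are negative. -/
lemma neg_one_pow_mul_prod_pos {d i : ℕ} {r : ℕ → ℝ} (hr : StrictAntiOn r (Set.Iio d))
    (hi : i < d) : 0 < (-1) ^ i * ∏ j ∈ (Finset.range d).erase i, (r i - r j) := by
  have hsplit : (Finset.range d).erase i = Finset.range i ∪ Finset.Ioo i d := by
    ext j; simp; omega
  have hdisj : Disjoint (Finset.range i) (Finset.Ioo i d) := by
    rw [Finset.disjoint_left]; intro j; simp; omega
  have hneg : ∏ j ∈ Finset.range i, (r i - r j) =
      (-1) ^ i * ∏ j ∈ Finset.range i, (r j - r i) := by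
    conv_rhs => rw [← Finset.card_range i, ← Finset.prod_const, Finset.card_range i,
      ← Finset.prod_mul_distrib]
    exact Finset.prod_congr rfl fun j _ => by ring
  rw [hsplit, Finset.prod_union hdisj, hneg, ← mul_assoc, ← mul_assoc, ← mul_pow]
  norm_num
  refine mul_pos (Finset.prod_pos fun j hj => ?_) (Finset.prod_pos fun j hj => ?_)
  · rw [Finset.mem_range] at hj
    exact sub_pos.2 (hr (Set.mem_Iio.2 (by omega)) (Set.mem_Iio.2 hi) hj)
  · rw [Finset.mem_Ioo] at hj
    exact sub_pos.2 (hr (Set.mem_Iio.2 hi) (Set.mem_Iio.2 hj.2) hj.1)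

namespace HasSimpleZeros

variable {d : ℕ} {r : ℕ → ℝ} {p : ℝ[X]}

lemma eval_eq_zero (h : HasSimpleZeros d r p) {i : ℕ} (hi : i < d) : p.eval (r i) = 0 := by
  rw [h.eq_prod, eval_mul, eval_prod, Finset.prod_eq_zero (Finset.mem_range.2 hi) (by simp),
    mul_zero]

lemma derivative_sign (h : HasSimpleZeros d r p) {i : ℕ} (hi : i < d) :
    0 < (-1) ^ i * (derivative p).eval (r i) := by
  have hd : (derivative p).eval (r i) =
      p.leadingCoeff * ∏ j ∈ (Finset.range d).erase i, (r i - r j) := by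
    have hmem : i ∈ Finset.range d := Finset.mem_range.2 hi
    conv_lhs => rw [h.eq_prod, ← Finset.mul_prod_erase _ _ hmem]
    simp [derivative_mul, eval_prod]
  rw [hd, mul_left_comm]
  exact mul_pos h.pos (neg_one_pow_mul_prod_pos h.strictAntiOn hi)

lemma ne_zero (h : HasSimpleZeros d r p) : p ≠ 0 :=
  leadingCoeff_ne_zero.1 h.pos.ne'

lemma roots_eq (h : HasSimpleZeros d r p) : p.roots = (Multiset.range d).map r := by
  rw [h.eq_prod, roots_C_mul _ h.pos.ne']
  have := roots_multiset_prod_X_sub_C ((Multiset.range d).map r)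
  rw [Multiset.map_map] at this
  exact this

lemma splits (h : HasSimpleZeros d r p) : p.Splits := by
  rw [h.eq_prod]
  exact (Splits.prod fun i _ => Splits.X_sub_C _).C_mul _

lemma zerosDesc_eq (h : HasSimpleZeros d r p) : zerosDesc p = (List.range d).map r := by
  refine List.Perm.eq_of_pairwise (le := (· ≥ ·)) (fun a b _ _ h1 h2 => le_antisymm h2 h1)
    (Multiset.pairwise_sort _ _) ?_ ?_
  · rw [List.pairwise_map]
    refine List.Pairwise.imp_of_mem ?_ List.pairwise_lt_range
    intro a b ha hb hab
    exact (h.strictAntiOn (List.mem_range.1 ha) (List.mem_range.1 hb) hab).le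
  · rw [← Multiset.coe_eq_coe, zerosDesc, Multiset.sort_eq, h.roots_eq]
    rfl

end HasSimpleZeros

lemma hasSimpleZeros_of_eval_eq_zero {d : ℕ} {s : ℕ → ℝ} {p : ℝ[X]}
    (hs : StrictAntiOn s (Set.Iio d)) (hp : 0 < p.leadingCoeff) (hdeg : p.natDegree ≤ d)
    (h0 : ∀ i < d, p.eval (s i) = 0) : HasSimpleZeros d s p := by
  have hp0 : p ≠ 0 := leadingCoeff_ne_zero.1 hp.ne'
  have hinj : Set.InjOn s (Finset.range d) := by
    simpa using hs.injOn
  have hsub : ((Finset.range d).image s).val ≤ p.roots := by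
    rw [Finset.val_le_iff_val_subset]
    intro x hx
    rw [Finset.mem_val, Finset.mem_image] at hx
    obtain ⟨i, hi, rfl⟩ := hx
    exact (mem_roots hp0).2 (h0 i (Finset.mem_range.1 hi))
  have hcard : ((Finset.range d).image s).val.card = d := by
    rw [Finset.card_val, Finset.card_image_of_injOn hinj, Finset.card_range]
  have hroots : ((Finset.range d).image s).val = p.roots :=
    Multiset.eq_of_le_of_card_le hsub (by
      rw [hcard]; exact (card_roots' p).trans hdeg)
  refine ⟨hs, hp, ?_⟩
  have hprod := C_leadingCoeff_mul_prod_multiset_X_sub_C (p := p) (le_antisymm (card_roots' p)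
    (by rw [← hroots, hcard]; exact hdeg))
  rw [← hroots] at hprod
  conv_lhs => rw [← hprod]
  congr 1
  exact Finset.prod_image hinj

lemma exists_lt_neg_one_pow_mul_eval_pos {p : ℝ[X]} (hp : 0 < p.leadingCoeff)
    (hdeg : 0 < p.natDegree) (a : ℝ) : ∃ x < a, 0 < (-1) ^ p.natDegree * p.eval x := by
  have hcomp : (p.comp (-X)).natDegree = p.natDegree := by
    rw [natDegree_comp]; simp
  have hlc : (p.comp (-X)).leadingCoeff = p.leadingCoeff * (-1) ^ p.natDegree := by
    rw [leadingCoeff_comp (by simp)]; simp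
  have hc : ((-1 : ℝ) ^ p.natDegree) ≠ 0 := by simp
  have ht := tendsto_atTop_of_leadingCoeff_nonneg (C ((-1 : ℝ) ^ p.natDegree) * p.comp (-X))
    (natDegree_pos_iff_degree_pos.1 (by rw [natDegree_C_mul hc, hcomp]; exact hdeg))
    (by
      rw [leadingCoeff_mul, leadingCoeff_C, hlc, mul_left_comm, ← mul_pow]
      norm_num
      exact hp.le)
  obtain ⟨y, hy1, hy2⟩ := ((ht.eventually_gt_atTop 0).and
    (Filter.eventually_gt_atTop (-a))).exists
  refine ⟨-y, by linarith, ?_⟩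
  simpa using hy1

lemma exists_root_Ioo {p : ℝ[X]} {a b : ℝ} (hab : a < b) (i : ℕ)
    (hb : 0 < (-1) ^ i * p.eval b) (ha : 0 < (-1) ^ (i + 1) * p.eval a) :
    ∃ x ∈ Set.Ioo a b, p.eval x = 0 := by
  have hcont : ContinuousOn (fun x => (-1) ^ i * p.eval x) (Set.Icc a b) :=
    (continuous_const.mul p.continuous).continuousOn
  have ha' : (-1) ^ i * p.eval a < 0 := by rw [pow_succ] at ha; linarith
  obtain ⟨x, hx, h0⟩ := intermediate_value_Ioo hab.le hcont ⟨ha', hb⟩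
  exact ⟨x, hx, (mul_eq_zero.1 h0).resolve_left (by simp)⟩

/-- A polynomial of degree `d + 1` with alternating signs at `r 0 > ⋯ > r (d - 1)` and
positive at some `M > r 0` has simple zeros separated by these points. -/
lemma exists_hasSimpleZeros_of_alternating {d : ℕ} {r : ℕ → ℝ} {p : ℝ[X]} {M : ℝ}
    (hr : StrictAntiOn r (Set.Iio d)) (hM : ∀ i < d, r i < M) (hpM : 0 < p.eval M)
    (hp : 0 < p.leadingCoeff) (hdeg : p.natDegree = d + 1)
    (hsign : ∀ i < d, 0 < (-1) ^ (i + 1) * p.eval (r i)) :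
    ∃ s : ℕ → ℝ, HasSimpleZeros (d + 1) s p ∧ (∀ i < d + 1, s i < M) ∧
      (∀ i < d, r i < s i) ∧ ∀ i < d, s (i + 1) < r i := by
  obtain ⟨m, hm, hpm⟩ := exists_lt_neg_one_pow_mul_eval_pos hp (by omega)
    (if d = 0 then M else r (d - 1))
  rw [hdeg] at hpm
  -- The decreasing points `M, r 0, …, r (d - 1), m` carry alternating signs of `p`; each of the `d
  -- + 1` gaps holds a zero, and the degree leaves no others.
  let t : ℕ → ℝ := fun i => if i = 0 then M else if i ≤ d then r (i - 1) else m
  have ht0 : t 0 = M := rfl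
  have htr : ∀ i < d, t (i + 1) = r i := fun i hi => by
    simp [t, show i + 1 ≤ d by omega]
  have htm : t (d + 1) = m := by simp [t]
  have htsign : ∀ i ≤ d + 1, 0 < (-1) ^ i * p.eval (t i) := by
    intro i hi
    rcases i with _ | i
    · simpa [ht0] using hpM
    · rcases Nat.lt_or_ge i d with h | h
      · rw [htr i h]; exact hsign i h
      · obtain rfl : i = d := by omega
        rw [htm]; exact hpm
  have htlt : ∀ i ≤ d, t (i + 1) < t i := by
    intro i hi
    rcases Nat.lt_or_ge i d with h | h
    · rw [htr i h]
      rcases i with _ | i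
      · exact hM 0 h
      · rw [htr i (by omega)]
        exact hr (Set.mem_Iio.2 (by omega)) (Set.mem_Iio.2 h) (Nat.lt_succ_self i)
    · obtain rfl : i = d := by omega
      rw [htm]
      rcases i with _ | i
      · rw [ht0]; simpa using hm
      · rw [htr i (by omega)]; simpa using hm
  have hex : ∀ i, ∃ x, i ≤ d → x ∈ Set.Ioo (t (i + 1)) (t i) ∧ p.eval x = 0 := by
    intro i
    by_cases hi : i ≤ d
    · obtain ⟨x, hx⟩ := exists_root_Ioo (htlt i hi) i (htsign i (by omega))
        (htsign (i + 1) (by omega))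
      exact ⟨x, fun _ => hx⟩
    · exact ⟨0, fun h => absurd h hi⟩
  choose s hs using hex
  have htanti : ∀ i j, i ≤ j → j ≤ d + 1 → t j ≤ t i := by
    intro i j hij
    induction j, hij using Nat.le_induction with
    | base => exact fun _ => le_rfl
    | succ j hij ih => exact fun hj => (htlt j (by omega)).le.trans (ih (by omega))
  refine ⟨s, hasSimpleZeros_of_eval_eq_zero ?_ hp hdeg.le fun i hi => (hs i (by omega)).2, ?_,
    ?_, ?_⟩
  · intro i hi j hj hij
    rw [Set.mem_Iio] at hi hj
    calc s j < t j := (hs j (by omega)).1.2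
      _ ≤ t (i + 1) := htanti _ _ hij (by omega)
      _ < s i := (hs i (by omega)).1.1
  · intro i hi
    exact (hs i (by omega)).1.2.trans_le (htanti 0 i (by omega) (by omega))
  · intro i hi
    rw [← htr i hi]; exact (hs i (by omega)).1.1
  · intro i hi
    rw [← htr i hi]; exact (hs (i + 1) (by omega)).1.2

/-! ### Multiplying by `X` -/

lemma HasSimpleZeros.const_mul_X_mul {d : ℕ} {r : ℕ → ℝ} {p : ℝ[X]} (h : HasSimpleZeros d r p)
    (hneg : ∀ i < d, r i < 0) {c : ℝ} (hc : 0 < c) :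
    HasSimpleZeros (d + 1) (fun i => if i = 0 then 0 else r (i - 1)) (C c * X * p) := by
  have hlc : (C c * X * p).leadingCoeff = c * p.leadingCoeff := by
    simp [leadingCoeff_mul]
  refine ⟨?_, by rw [hlc]; exact mul_pos hc h.pos, ?_⟩
  · intro i hi j hj hij
    rw [Set.mem_Iio] at hi hj
    rcases j with _ | j
    · omega
    · rcases i with _ | i
      · simpa using hneg j (by omega)
      · simpa using h.strictAntiOn (Set.mem_Iio.2 (by omega)) (Set.mem_Iio.2 (by omega))
          (Nat.lt_of_succ_lt_succ hij)
  · rw [hlc, Finset.prod_range_succ']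
    conv_lhs => rw [h.eq_prod]
    simp
    ring

lemma interlaces_const_mul_X_mul {d : ℕ} {r s : ℕ → ℝ} {p q : ℝ[X]}
    (hp : HasSimpleZeros d r p) (hq : HasSimpleZeros (d + 1) s q)
    (hr : ∀ i < d, r i < 0) (hs : ∀ i < d + 1, s i < 0)
    (hrs : ∀ i < d, r i ≤ s i) (hsr : ∀ i < d, s (i + 1) ≤ r i)
    {a b : ℝ} (ha : 0 < a) (hb : 0 < b)
    (hpc : ∀ i, 0 ≤ (C a * X * p).coeff i) (hqc : ∀ i, 0 ≤ (C b * X * q).coeff i) :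
    Interlaces (C a * X * p) (C b * X * q) := by
  have hp' := hp.const_mul_X_mul hr ha
  have hq' := hq.const_mul_X_mul hs hb
  refine ⟨hp'.splits, hq'.splits, Or.inl ⟨hpc, hqc, hp'.ne_zero, hq'.ne_zero, Or.inr ?_, ?_⟩⟩
  · rw [hp'.splits.natDegree_eq_card_roots, hq'.splits.natDegree_eq_card_roots, hp'.roots_eq,
      hq'.roots_eq]
    simp
  · rw [hp'.zerosDesc_eq, hq'.zerosDesc_eq]
    constructor
    · intro i hi _
      simp only [List.length_map, List.length_range] at hi
      rcases i with _ | i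
      · simp
      · simpa using hrs i (by omega)
    · intro i hi _
      simp only [List.length_map, List.length_range] at hi
      rcases i with _ | i
      · simpa using (hs 0 (by omega)).le
      · simpa using hsr i (by omega)

/-- Serves the two proportional middle polynomials when `n` is odd. -/
lemma interlaces_self {p q : ℝ[X]} (hp : RealRooted p) (hp0 : p ≠ 0)
    (hpc : ∀ i, 0 ≤ p.coeff i) {c : ℝ} (hc : 0 < c) (hq : q = C c * p) : Interlaces p q := by
  subst hq
  refine ⟨hp, hp.C_mul c, Or.inl ⟨hpc, fun i => ?_, hp0, ?_, Or.inl ?_, ?_⟩⟩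
  · rw [coeff_C_mul]; exact mul_nonneg hc.le (hpc i)
  · exact mul_ne_zero (by simpa using hc.ne') hp0
  · exact natDegree_C_mul hc.ne'
  · rw [zerosDesc, zerosDesc, roots_C_mul _ hc.ne']
    refine ⟨fun i _ _ => le_rfl, fun i h _ => ?_⟩
    exact (List.pairwise_iff_getElem.1 (Multiset.pairwise_sort p.roots (· ≥ ·))) i (i + 1) _ _
      (Nat.lt_succ_self i)

/-! ### The polynomials `∑ C(a,j) C(b,j) x^j / (j + 1)` -/

/-- The polynomial `∑ C(a,j) C(b,j) x^j / (j + 1)`. -/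
noncomputable def narayanaPoly (a b : ℕ) : ℝ[X] :=
  ∑ j ∈ Finset.range (a + 1), C ((a.choose j * b.choose j : ℝ) / (j + 1)) * X ^ j

lemma coeff_narayanaPoly (a b j : ℕ) :
    (narayanaPoly a b).coeff j = (a.choose j * b.choose j : ℝ) / (j + 1) := by
  simp only [narayanaPoly, finsetSum_coeff, coeff_C_mul_X_pow]
  rw [Finset.sum_ite_eq]
  split_ifs with h
  · rfl
  · rw [Finset.mem_range] at h
    rw [Nat.choose_eq_zero_of_lt (by omega)]
    simp

lemma narayanaPoly_comm (a b : ℕ) : narayanaPoly a b = narayanaPoly b a := by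
  ext j
  rw [coeff_narayanaPoly, coeff_narayanaPoly, mul_comm (a.choose j : ℝ)]

lemma coeff_narayanaPoly_nonneg (a b j : ℕ) : 0 ≤ (narayanaPoly a b).coeff j := by
  rw [coeff_narayanaPoly]; positivity

lemma eval_zero_narayanaPoly (a b : ℕ) : (narayanaPoly a b).eval 0 = 1 := by
  rw [← coeff_zero_eq_eval_zero, coeff_narayanaPoly]; simp

lemma natDegree_narayanaPoly {a b : ℕ} (h : a ≤ b) : (narayanaPoly a b).natDegree = a := by
  refine natDegree_eq_of_le_of_coeff_ne_zero ?_ ?_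
  · rw [natDegree_le_iff_coeff_eq_zero]
    intro j hj
    rw [coeff_narayanaPoly, Nat.choose_eq_zero_of_lt hj]; simp
  · have : (b.choose a : ℝ) ≠ 0 := by exact_mod_cast (Nat.choose_pos h).ne'
    rw [coeff_narayanaPoly, Nat.choose_self]; positivity

lemma leadingCoeff_narayanaPoly_pos {a b : ℕ} (h : a ≤ b) :
    0 < (narayanaPoly a b).leadingCoeff := by
  have : (0 : ℝ) < b.choose a := by exact_mod_cast Nat.choose_pos h
  rw [leadingCoeff, natDegree_narayanaPoly h, coeff_narayanaPoly, Nat.choose_self]; positivity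

/-- At a zero r < 0 of P(a,b) only the derivative term survives, and its factor r(1-r) is negative:
P(a+1,b) has there the sign opposite to the derivative of P(a,b). -/
lemma narayanaPoly_succ_left (a b : ℕ) :
    C ((a : ℝ) + 2) * narayanaPoly (a + 1) b =
      (C ((a : ℝ) + 2) + C (b : ℝ) * X) * narayanaPoly a b +
        X * (1 - X) * derivative (narayanaPoly a b) := by
  have hexp : (C ((a : ℝ) + 2) + C (b : ℝ) * X) * narayanaPoly a b +
        X * (1 - X) * derivative (narayanaPoly a b) =
      C ((a : ℝ) + 2) * narayanaPoly a b + C (b : ℝ) * (X * narayanaPoly a b) +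
        (X * derivative (narayanaPoly a b) - X * (X * derivative (narayanaPoly a b))) := by ring
  rw [hexp]
  ext j
  rcases j with _ | j
  · simp [coeff_narayanaPoly]
  · have hX : (X * (X * derivative (narayanaPoly a b))).coeff (j + 1) =
        j * (narayanaPoly a b).coeff j := by
      rw [coeff_X_mul]
      rcases j with _ | j
      · simp
      · rw [coeff_X_mul, coeff_derivative]; push_cast; ring
    rw [coeff_add, coeff_add, coeff_sub, hX, coeff_C_mul, coeff_C_mul, coeff_C_mul, coeff_X_mul,
      coeff_X_mul, coeff_derivative]
    simp only [coeff_narayanaPoly]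
    have h1 : ((a + 1).choose (j + 1) : ℝ) = a.choose j + a.choose (j + 1) := by
      exact_mod_cast Nat.choose_succ_succ a j
    have h2 : ((a : ℝ) + 1) * a.choose j = (a + 1).choose (j + 1) * (j + 1) := by
      exact_mod_cast Nat.add_one_mul_choose_eq a j
    have h3 : ((b : ℝ) + 1) * b.choose j = (b + 1).choose (j + 1) * (j + 1) := by
      exact_mod_cast Nat.add_one_mul_choose_eq b j
    have h4 : ((b + 1).choose (j + 1) : ℝ) = b.choose j + b.choose (j + 1) := by
      exact_mod_cast Nat.choose_succ_succ b j
    rw [h1] at h2 ⊢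
    rw [h4] at h3
    have hj : (j : ℝ) + 1 ≠ 0 := by positivity
    have h5 : (a.choose (j + 1) : ℝ) = (a - j) * a.choose j / (j + 1) := by
      field_simp; linarith
    have h6 : (b.choose (j + 1) : ℝ) = (b - j) * b.choose j / (j + 1) := by
      field_simp; linarith
    rw [h5, h6]
    push_cast
    field_simp
    ring

/-- From (a+1) C(a,j) = (a+1-j) C(a+1,j) and its analogue for `b`; subtracting cancels `j`. At the
zeros of P(a,b+1) it compares P(a+1,b) with P(a+1,b+1), whose signs are known; the factor b-a is why
`a < b` is needed. -/
lemma narayanaPoly_shift (a b : ℕ) :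
    C ((b : ℝ) + 1) * narayanaPoly (a + 1) b =
      C ((b : ℝ) - a) * narayanaPoly (a + 1) (b + 1) +
        C ((a : ℝ) + 1) * narayanaPoly a (b + 1) := by
  have key : ∀ a j : ℕ, ((a : ℝ) + 1) * a.choose j = (a + 1 - j) * (a + 1).choose j := by
    intro a j
    rcases le_or_gt j (a + 1) with h | h
    · have := Nat.choose_mul_succ_eq a j
      have : ((a.choose j * (a + 1) : ℕ) : ℝ) = ((a + 1).choose j * (a + 1 - j) : ℕ) := by
        exact_mod_cast this
      push_cast [Nat.cast_sub h] at this
      linarith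
    · rw [Nat.choose_eq_zero_of_lt h, Nat.choose_eq_zero_of_lt (by omega)]
      simp
  ext j
  rw [coeff_add, coeff_C_mul, coeff_C_mul, coeff_C_mul]
  simp only [coeff_narayanaPoly]
  have h1 := key a j
  have h2 := key b j
  have hj : (j : ℝ) + 1 ≠ 0 := by positivity
  field_simp
  linear_combination ((a + 1).choose j : ℝ) * h2 - ((b + 1).choose j : ℝ) * h1

/-- The signs of `p(a+1,b)` at the zeros of `p(a,b)` alternate. -/
lemma narayanaPoly_succ_left_sign {a b : ℕ} {r : ℕ → ℝ}
    (h : HasSimpleZeros a r (narayanaPoly a b)) (hr : ∀ i < a, r i < 0) {i : ℕ} (hi : i < a) :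
    0 < (-1) ^ (i + 1) * (narayanaPoly (a + 1) b).eval (r i) := by
  have h1 := congrArg (eval (r i)) (narayanaPoly_succ_left a b)
  simp only [eval_mul, eval_add, eval_sub, eval_C, eval_X, eval_one, h.eval_eq_zero hi, mul_zero,
    zero_add] at h1
  have h2 := h.derivative_sign hi
  have h3 := hr i hi
  have ha : (0 : ℝ) < a + 2 := by positivity
  have h4 : ((a : ℝ) + 2) * ((-1) ^ (i + 1) * (narayanaPoly (a + 1) b).eval (r i)) =
      (-r i * (1 - r i)) * ((-1) ^ i * (derivative (narayanaPoly a b)).eval (r i)) := by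
    rw [pow_succ]; linear_combination (-(-1) ^ i) * h1
  refine pos_of_mul_pos_right (a := (a : ℝ) + 2) ?_ ha.le
  rw [h4]
  exact mul_pos (mul_pos (by linarith) (by linarith)) h2

lemma exists_hasSimpleZeros_narayanaPoly (a b : ℕ) (h : a ≤ b) :
    ∃ r : ℕ → ℝ, HasSimpleZeros a r (narayanaPoly a b) ∧ ∀ i < a, r i < 0 := by
  induction a with
  | zero =>
    refine ⟨fun _ => 0, hasSimpleZeros_of_eval_eq_zero ?_ (leadingCoeff_narayanaPoly_pos h)
      (natDegree_narayanaPoly h).le ?_, ?_⟩ <;> simp [StrictAntiOn]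
  | succ a ih =>
    obtain ⟨r, hr, hneg⟩ := ih (by omega)
    -- The right endpoint is `M = 0`, where P equals 1; hence the new zeros are again negative.
    obtain ⟨s, hs, hs0, -⟩ := exists_hasSimpleZeros_of_alternating
      (p := narayanaPoly (a + 1) b) hr.strictAntiOn hneg
      (by rw [eval_zero_narayanaPoly]; exact one_pos) (leadingCoeff_narayanaPoly_pos h)
      (natDegree_narayanaPoly h) fun i hi => narayanaPoly_succ_left_sign hr hneg hi
    exact ⟨s, hs, hs0⟩

lemma coeff_const_mul_X_mul_nonneg {c : ℝ} (hc : 0 ≤ c) {p : ℝ[X]} (hp : ∀ i, 0 ≤ p.coeff i)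
    (i : ℕ) : 0 ≤ (C c * X * p).coeff i := by
  rw [mul_assoc, coeff_C_mul]
  refine mul_nonneg hc ?_
  rcases i with _ | i
  · simp
  · rw [coeff_X_mul]; exact hp i

theorem interlaces_narayanaPoly {a b : ℕ} (h : a < b) {c c' : ℝ} (hc : 0 < c) (hc' : 0 < c') :
    Interlaces (C c * X * narayanaPoly a (b + 1)) (C c' * X * narayanaPoly (a + 1) b) := by
  obtain ⟨r, hr, hneg⟩ := exists_hasSimpleZeros_narayanaPoly a (b + 1) (by omega)
  obtain ⟨s, hs, hs0, hrs, hsr⟩ := exists_hasSimpleZeros_of_alternating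
      (p := narayanaPoly (a + 1) b) hr.strictAntiOn hneg
      (by rw [eval_zero_narayanaPoly]; exact one_pos) (leadingCoeff_narayanaPoly_pos h)
      (natDegree_narayanaPoly h) (by
    intro i hi
    have h1 := congrArg (eval (r i)) (narayanaPoly_shift a b)
    simp only [eval_mul, eval_add, eval_C, hr.eval_eq_zero hi, mul_zero, add_zero] at h1
    have hab : (0 : ℝ) < b - a := sub_pos.2 (by exact_mod_cast h)
    have hb : (0 : ℝ) < b + 1 := by positivity
    refine pos_of_mul_pos_right (a := (b : ℝ) + 1) ?_ hb.le
    rw [mul_left_comm, h1, mul_left_comm]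
    exact mul_pos hab (narayanaPoly_succ_left_sign hr hneg hi))
  exact interlaces_const_mul_X_mul hr hs hneg hs0 (fun i hi => (hrs i hi).le)
    (fun i hi => (hsr i hi).le) hc hc'
    (coeff_const_mul_X_mul_nonneg hc.le (coeff_narayanaPoly_nonneg _ _))
    (coeff_const_mul_X_mul_nonneg hc'.le (coeff_narayanaPoly_nonneg _ _))

lemma realRooted_narayanaPoly (a b : ℕ) : RealRooted (narayanaPoly a b) := by
  rcases le_total a b with h | h
  · obtain ⟨r, hr, -⟩ := exists_hasSimpleZeros_narayanaPoly a b h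
    exact hr.splits
  · obtain ⟨r, hr, -⟩ := exists_hasSimpleZeros_narayanaPoly b a h
    rw [narayanaPoly_comm]
    exact hr.splits

/-! ### The polynomials `W n k` -/

lemma coeff_W (n k m : ℕ) : (W n k).coeff m = if m ≤ k then (w n k m : ℝ) else 0 := by
  simp only [W, finsetSum_coeff, coeff_C_mul_X_pow]
  rw [Finset.sum_ite_eq]
  simp

/-- Here `n - k = b + 1 > 0`, so some `U`-run has length at least two and the constant term
vanishes; C(a+1,m+1) = (a+1)/(m+1) · C(a,m) does the rest. -/
lemma W_eq_narayanaPoly (a b : ℕ) :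
    ∃ c : ℝ, 0 < c ∧ W (a + b + 2) (a + 1) = C c * X * narayanaPoly a b := by
  have hpos : (0 : ℝ) < (a + b + 2).choose a := by
    exact_mod_cast Nat.choose_pos (by omega)
  refine ⟨(a + b + 2).choose a, hpos, ?_⟩
  ext m
  have hw : (w (a + b + 2) (a + 1) m : ℝ) =
      (a + b + 2).choose a / (a + 1) * ((a + 1).choose m * compCount (b + 1) m) := by
    have := w_succ (a + b + 2) a m
    have e := bigPartCount_add (a + 1) (b + 1) m
    rw [show a + b + 2 = a + 1 + (b + 1) by ring, e] at this
    rw [show a + b + 2 = a + 1 + (b + 1) by ring]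
    have hcast := congrArg (Rat.cast : ℚ → ℝ) this
    push_cast at hcast
    exact hcast
  rw [coeff_W, hw, mul_assoc, coeff_C_mul]
  rcases m with _ | m
  · simp [compCount]
  · rw [coeff_X_mul, coeff_narayanaPoly]
    split_ifs with h
    · have h2 : ((a : ℝ) + 1) * a.choose m = (a + 1).choose (m + 1) * (m + 1) := by
        exact_mod_cast Nat.add_one_mul_choose_eq a m
      simp only [compCount]
      field_simp
      linear_combination (-(b.choose m : ℝ)) * h2
    · rw [Nat.choose_eq_zero_of_lt (show a < m by omega)]
      simp

lemma W_self (n : ℕ) : ∃ c : ℝ, W (n + 1) (n + 1) = C c := by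
  refine ⟨w (n + 1) (n + 1) 0, ?_⟩
  ext m
  rw [coeff_W, coeff_C]
  rcases m with _ | m
  · simp
  · have := w_succ (n + 1) n (m + 1)
    rw [bigPartCount_self_succ, mul_zero] at this
    have h0 : w (n + 1) (n + 1) (m + 1) = 0 := by exact_mod_cast this
    simp [h0]

lemma realRooted_W {n k : ℕ} (hk : 1 ≤ k) (hkn : k ≤ n) : RealRooted (W n k) := by
  obtain ⟨a, rfl⟩ := Nat.exists_eq_add_of_le' hk
  rcases Nat.eq_or_lt_of_le hkn with rfl | h
  · obtain ⟨c, hc⟩ := W_self a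
    rw [hc]
    exact Splits.C c
  · obtain ⟨b, rfl⟩ : ∃ b, n = a + b + 2 := ⟨n - a - 2, by omega⟩
    obtain ⟨c, -, hc⟩ := W_eq_narayanaPoly a b
    rw [hc]
    exact (Splits.X.C_mul c).mul (realRooted_narayanaPoly a b)

lemma interlaces_W_succ {n k : ℕ} (hk : 1 ≤ k) (h : 2 * (k + 1) ≤ n) :
    Interlaces (W n k) (W n (k + 1)) := by
  obtain ⟨a, rfl⟩ := Nat.exists_eq_add_of_le' hk
  obtain ⟨b, rfl⟩ : ∃ b, n = a + (b + 1) + 2 := ⟨n - a - 3, by omega⟩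
  obtain ⟨c, hc, e⟩ := W_eq_narayanaPoly a (b + 1)
  obtain ⟨c', hc', e'⟩ := W_eq_narayanaPoly (a + 1) b
  rw [show a + 1 + b + 2 = a + (b + 1) + 2 by ring] at e'
  rw [e, e']
  exact interlaces_narayanaPoly (by omega) hc hc'

lemma interlaces_succ_W {n k : ℕ} (hk : 1 ≤ k) (hkn : k < n) (h : n ≤ 2 * k + 1) :
    Interlaces (W n (k + 1)) (W n k) := by
  obtain ⟨a, rfl⟩ := Nat.exists_eq_add_of_le' hk
  rcases Nat.eq_or_lt_of_le (Nat.succ_le_of_lt hkn) with rfl | h'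
  -- For `k + 1 = n` the pair is a constant and a multiple of `X`, covered by the convention.
  · obtain ⟨c, e⟩ := W_self (a + 1)
    obtain ⟨c', hc', e'⟩ := W_eq_narayanaPoly a 0
    refine ⟨realRooted_W (by omega) (by omega), realRooted_W (by omega) (by omega),
      Or.inr (Or.inl ⟨c, c', 0, e, ?_⟩)⟩
    have h1 : narayanaPoly a 0 = 1 := by
      rw [narayanaPoly_comm]; simp [narayanaPoly]
    change W (a + 0 + 2) (a + 1) = _
    rw [e', h1]
    simp
  · obtain ⟨b, rfl⟩ : ∃ b, n = a + (b + 1) + 2 := ⟨n - a - 3, by omega⟩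
    obtain ⟨c, hc, e⟩ := W_eq_narayanaPoly a (b + 1)
    obtain ⟨c', hc', e'⟩ := W_eq_narayanaPoly (a + 1) b
    rw [show a + 1 + b + 2 = a + (b + 1) + 2 by ring] at e'
    rw [narayanaPoly_comm] at e e'
    rcases Nat.lt_or_ge b a with hab | hab
    · rw [e, e']
      exact interlaces_narayanaPoly hab hc' hc
    -- Here `n = 2 * k + 1`, and symmetry makes the two polynomials proportional.
    · obtain rfl : a = b := by omega
      rw [narayanaPoly_comm] at e'
      have hne : W (a + (a + 1) + 2) (a + 1 + 1) ≠ 0 := by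
        intro h0
        have h1 := congrArg (fun p : ℝ[X] => p.coeff 1) h0
        simp only [e', mul_assoc, coeff_C_mul, coeff_X_mul, coeff_narayanaPoly] at h1
        simp [hc'.ne'] at h1
      refine interlaces_self (realRooted_W (by omega) (by omega)) hne (fun i => ?_)
        (div_pos hc hc') ?_
      · rw [coeff_W]; positivity
      · rw [e, e', ← mul_assoc, ← mul_assoc, ← C_mul, div_mul_cancel₀ _ hc'.ne']

end DyckSturm

theorem theorem2p7 (n : ℕ) (hn : 1 ≤ n) :
    DyckSturm.SturmUnimodal n (fun k => DyckSturm.W n k) := by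
  -- The peak is the centre of the symmetry `k ↔ n - k`, rounded down; the maximum with 1 matters
  -- only for `n = 1`.
  refine ⟨fun i h1 h2 => DyckSturm.realRooted_W h1 h2, max 1 (n / 2), le_max_left _ _, ?_, ?_, ?_⟩
  · omega
  · intro i h1 h2
    exact DyckSturm.interlaces_W_succ h1 (by omega)
  · intro i h1 h2
    exact DyckSturm.interlaces_succ_W (by omega) h2 (by omega)
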